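/- Let $\mathcal M=M_2(\mathbb R)$ be the algebra of real $2\times2$ matrices with identity $I$ and its usual (norm) topology. For $v\in\mathbb R$ put $$x(v)=\begin{pmatrix}-v&0\\0&-2v\end{pmatrix},\qquad y=\begin{pmatrix}0&1\\0&0\end{pmatrix}.$$ For $X,Y\in\mathcal M$, the Mercator series for $\ln(e^Xe^Y)$ is the series $\sum_{n\ge1}\frac{(-1)^{n+1}}{n}(e^Xe^Y-I)^n$, and the (homogeneous) Baker–Campbell–Hausdorff (BCH) series is $\sum_{n\ge1}Z_n(X,Y)$, where $$Z_n(X,Y)=\frac1n\sum_{k=1}^n\frac{(-1)^{k+1}}{k}\sum_{\substack{(i_1,j_1),\dots,(i_k,j_k)\in\mathbb N_0^2\setminus\{(0,0)\}\\ i_1+j_1+\cdots+i_k+j_k=n}}\frac{(\operatorname{ad}X)^{i_1}(\operatorname{ad}Y)^{j_1}\cdots(\operatorname{ad}X)^{i_k}(\operatorname{ad}Y)^{j_k-1}(Y)}{i_1!\,j_1!\cdots i_k!\,j_k!},$$ $(\operatorname{ad}a)(b)=[a,b]=ab-ba$, and for $j_k=0$ the numerator is understood to end with $(\operatorname{ad}X)^{i_k-1}(X)$.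 A series converges if its sequence of partial sums converges in $\mathcal M$. Then: (i) for every $v\in\mathbb R$, the Mercator series for $\ln(e^{x(v)}e^y)$ converges in $\mathcal M$ if and only if $v\ge-\ln\sqrt2$; (ii) for every $v\in\mathbb R$, the BCH series $\sum_{n\ge1}Z_n(x(v),y)$ converges in $\mathcal M$ if and only if $|v|<2\pi$; (iii) for every $v\in\mathbb R$, the matrix $$Z(v)=\begin{pmatrix}-v&\psi(v)\\0&-2v\end{pmatrix},\qquad \psi(v)=\frac{v}{1-e^{-v}}\ (v\ne0),\quad \psi(0)=1,$$ is a logarithm of $e^{x(v)}e^y$, that is, $e^{Z(v)}=e^{x(v)}e^y$. -/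

import Mathlib

open Filter Topology

noncomputable section

namespace BCHExample

/-- Convergence of the series `∑_{n ≥ 1} a n`, i.e. convergence of its sequence of partial sums
(no absolute or unconditional convergence is required). -/
def SeriesConverges {E : Type*} [AddCommMonoid E] [TopologicalSpace E] (a : ℕ → E) : Prop :=
  ∃ S : E, Tendsto (fun N : ℕ => ∑ n ∈ Finset.Icc 1 N, a n) atTop (𝓝 S)

/-- The `n`-th term (`n ≥ 1`) of the Mercator series for `ln (e^x e^y)`:
`L_n(x, y) = (-1)^(n+1) / n • (e^x e^y - I)^n`. -/
def mercatorTerm {A : Type*} [Ring A] [Algebra ℝ A] [TopologicalSpace A] [IsTopologicalRing A]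
    (x y : A) (n : ℕ) : A :=
  ((-1 : ℝ) ^ (n + 1) / (n : ℝ)) • (NormedSpace.exp x * NormedSpace.exp y - 1) ^ n

/-- `V` is a logarithm of `W` if `e^V = W`. -/
def IsLogarithm {A : Type*} [Ring A] [Algebra ℝ A] [TopologicalSpace A] [IsTopologicalRing A]
    (V W : A) : Prop :=
  NormedSpace.exp V = W

/-- The nested commutator
`(ad x)^{i_1} (ad y)^{j_1} ⋯ (ad x)^{i_k} (ad y)^{j_k - 1} (y)`
attached to a list of pairs `(i_1, j_1), …, (i_k, j_k)`; when `j_k = 0` it is understood to end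
with `(ad x)^{i_k - 1} (x)`. It is used only for nonempty lists of pairs different from `(0, 0)`. -/
def dynkinBracket {L : Type*} [LieRing L] [LieAlgebra ℝ L] (x y : L) : List (ℕ × ℕ) → L
  | [] => 0
  | [q] =>
      if q.2 = 0 then ((LieAlgebra.ad ℝ L x) ^ (q.1 - 1)) x
      else ((LieAlgebra.ad ℝ L x) ^ q.1) (((LieAlgebra.ad ℝ L y) ^ (q.2 - 1)) y)
  | q :: r :: s =>
      ((LieAlgebra.ad ℝ L x) ^ q.1) (((LieAlgebra.ad ℝ L y) ^ q.2) (dynkinBracket x y (r :: s)))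

/-- The finite set of `k`-tuples of pairs `(i_1, j_1), …, (i_k, j_k)` of natural numbers, all
different from `(0, 0)`, with `i_1 + j_1 + ⋯ + i_k + j_k = n` (each entry is then at most `n`). -/
def dynkinIndices (n k : ℕ) : Finset (Fin k → ℕ × ℕ) :=
  (Fintype.piFinset fun _ : Fin k => Finset.range (n + 1) ×ˢ Finset.range (n + 1)).filter
    fun p => (∀ l, p l ≠ (0, 0)) ∧ ∑ l, ((p l).1 + (p l).2) = n

/-- The homogeneous component `Z_n(x, y)` of degree `n` of the Baker-Campbell-Hausdorff series,
in Dynkin's presentation. -/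
def bchTerm {L : Type*} [LieRing L] [LieAlgebra ℝ L] (x y : L) (n : ℕ) : L :=
  (1 / (n : ℝ)) • ∑ k ∈ Finset.Icc 1 n, ((-1 : ℝ) ^ (k + 1) / (k : ℝ)) •
    ∑ p ∈ dynkinIndices n k,
      (1 / (∏ l, (((p l).1.factorial : ℝ) * ((p l).2.factorial : ℝ)))) •
        dynkinBracket x y (List.ofFn p)

/-- Todd's function `ψ(v) = v / (1 - e^{-v})`, with `ψ(0) = 1`. -/
def todd (v : ℝ) : ℝ :=
  if v = 0 then 1 else v / (1 - Real.exp (-v))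

/-- The matrix `x(v) = diag(-v, -2v)`. -/
def xMat (v : ℝ) : Matrix (Fin 2) (Fin 2) ℝ :=
  !![-v, 0; 0, -2 * v]

/-- The matrix `y = E_{12}`. -/
def yMat : Matrix (Fin 2) (Fin 2) ℝ :=
  !![0, 1; 0, 0]

/-- The matrix `Z(v)` with rows `(-v, ψ(v))` and `(0, -2v)`. -/
def zMat (v : ℝ) : Matrix (Fin 2) (Fin 2) ℝ :=
  !![-v, todd v; 0, -2 * v]

end BCHExample

end

/- The Lie bracket on an associative ring is the commutator `⁅a, b⁆ = a * b - b * a`. -/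
attribute [local instance 100] LieRing.ofAssociativeRing

/-! Everything rests on `[x, y] = v y`. In a Dynkin bracket `ad x` kills `x` and multiplies `y` by
`v`, while `ad y` kills `y` and sends `x` to `-v y`. So for `n ≥ 2` every surviving bracket is
linear in `y`, and `Z_n` is `v^(n-1)` times a universal constant times `y`. The block sums obey a
one-step recursion (`dynkinSum_eq`). Summed with the logarithm's coefficients, their generating
functions collapse because `log (e^t) = t` up to high order, and the constant is `bernoulli' (n-1) /
(n-1)!` (`bchTerm_eq`).

Euler's formula for `ζ(2k)` puts `|b_{2k}| (2π)^{2k} / (2k)!` between 2 and `2 ζ(2)`: the terms are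
dominated geometrically if `|v| < 2π` and do not tend to zero otherwise.

With `a = e^{-v}`, the matrix `e^x e^y - I` is upper triangular with eigenvalues `a - 1` and `a^2 -
1`, so the Mercator series reduces to the scalar series for `log (1 + t)`, convergent for `-1 < t ≤
1`; the binding condition is `a^2 ≤ 2`. -/

namespace BCHExample

/-! ### Formal power series: from the block sums to Bernoulli numbers. -/

section PowerSeriesIdentity

open PowerSeries

/-- The partial sum `∑_{k=1}^N (-1)^(k+1)/k (e^t - 1)^k` of the logarithm of `e^t`. -/
noncomputable def logExpPartial (N : ℕ) : PowerSeries ℝ :=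
  ∑ k ∈ Finset.range N, C ((-1 : ℝ) ^ (k + 2) / ((k + 1 : ℕ) : ℝ)) * (exp ℝ - 1) ^ (k + 1)

lemma X_dvd_exp_sub_one : (X : PowerSeries ℝ) ∣ exp ℝ - 1 := by
  rw [X_dvd_iff]; simp

/-- With `u = e^t - 1`, each summand has derivative `(-u)^k (1 + u)`, and the sum telescopes. -/
lemma derivative_logExpPartial (N : ℕ) :
    derivative ℝ (logExpPartial N) = 1 - (-(exp ℝ - 1)) ^ N := by
  induction N with
  | zero => simp [logExpPartial]
  | succ N ih =>
    rw [logExpPartial, Finset.sum_range_succ, map_add, ← logExpPartial, ih, Derivation.leibniz,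
      derivative_pow, derivative_C, map_sub, derivative_exp, derivative_one]
    have h : C ((-1 : ℝ) ^ (N + 2) / ((N + 1 : ℕ) : ℝ)) * ((N + 1 : ℕ) : PowerSeries ℝ)
        = (-1) ^ N := by
      rw [← map_natCast (C : ℝ →+* PowerSeries ℝ), ← map_mul, div_mul_cancel₀ _ (by positivity)]
      simp [pow_add]
    simp only [smul_eq_mul, Nat.add_sub_cancel, mul_zero, add_zero, sub_zero]
    rw [pow_succ (-(exp ℝ - 1)), neg_pow (exp ℝ - 1)]
    linear_combination (exp ℝ - 1) ^ N * exp ℝ * h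

lemma X_pow_dvd_logExpPartial_sub (N : ℕ) :
    (X : PowerSeries ℝ) ^ (N + 1) ∣ logExpPartial N - X := by
  have hd : (X : PowerSeries ℝ) ^ N ∣ derivative ℝ (logExpPartial N - X) := by
    rw [map_sub, derivative_logExpPartial, derivative_X, sub_sub_cancel_left, dvd_neg]
    exact pow_dvd_pow_of_dvd ((dvd_neg).2 X_dvd_exp_sub_one) N
  rw [X_pow_dvd_iff] at hd ⊢
  intro m hm
  cases m with
  | zero =>
    simp [logExpPartial]
  | succ m =>
    have := hd m (by omega)
    rw [coeff_derivative] at this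
    exact (mul_eq_zero.1 this).resolve_right (by positivity)

/-- Generating function of the coefficients of `y` in the `(k + 1)`-block Dynkin brackets. -/
noncomputable def blockSeries : ℕ → PowerSeries ℝ
  | 0 => X * exp ℝ
  | k + 1 => X * exp ℝ * (exp ℝ - 1) ^ (k + 1) - X ^ 2 * exp ℝ * (exp ℝ - 1) ^ k

/-- The factor `(e^t - 1)^2` avoids division. The second logarithm lacks its linear term because
`blockSeries 0` has no `X ^ 2` part. -/
lemma sum_blockSeries_mul (N : ℕ) :
    (∑ k ∈ Finset.range (N + 1), C ((-1 : ℝ) ^ (k + 2) / ((k + 1 : ℕ) : ℝ)) * blockSeries k) *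
        (exp ℝ - 1) ^ 2 =
      X * exp ℝ * (exp ℝ - 1) * logExpPartial (N + 1) -
        X ^ 2 * exp ℝ * (logExpPartial (N + 1) - (exp ℝ - 1)) := by
  induction N with
  | zero => simp [logExpPartial, blockSeries]; ring
  | succ N ih =>
    rw [Finset.sum_range_succ, add_mul, ih]
    simp only [logExpPartial, Finset.sum_range_succ _ (N + 1), blockSeries]
    ring

/-- The right side is that of `sum_blockSeries_mul` with the partial logarithm replaced by its limit
`X`. -/
lemma X_mul_derivative_bernoulli :
    X * derivative ℝ (X * bernoulli'PowerSeries ℝ) * (exp ℝ - 1) ^ 2 =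
      X * exp ℝ * (exp ℝ - 1) * X - X ^ 2 * exp ℝ * (X - (exp ℝ - 1)) := by
  have h := bernoulli'PowerSeries_mul_exp_sub_one ℝ
  have h' := congrArg (derivative ℝ) h
  simp only [Derivation.leibniz, map_sub, derivative_exp, derivative_one, derivative_X,
    smul_eq_mul] at h' ⊢
  linear_combination (X ^ 2 * (exp ℝ - 1)) * h' +
    (X * (exp ℝ - 1) - X ^ 2 * exp ℝ) * h

lemma sum_coeff_blockSeries (n : ℕ) (hn : n ≠ 0) :
    ∑ k ∈ Finset.range n, ((-1 : ℝ) ^ (k + 2) / ((k + 1 : ℕ) : ℝ)) * coeff n (blockSeries k) =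
      n * ((bernoulli' (n - 1) : ℝ) / ((n - 1).factorial : ℝ)) := by
  obtain ⟨N, rfl⟩ := Nat.exists_eq_succ_of_ne_zero hn
  set S : PowerSeries ℝ := ∑ k ∈ Finset.range (N + 1),
    C ((-1 : ℝ) ^ (k + 2) / ((k + 1 : ℕ) : ℝ)) * blockSeries k with hS
  set G : PowerSeries ℝ := X * derivative ℝ (X * bernoulli'PowerSeries ℝ) with hG
  obtain ⟨F, hF⟩ := X_dvd_exp_sub_one
  have hF0 : constantCoeff F ≠ 0 := by
    have := congrArg (coeff 1) hF
    rw [show (1 : ℕ) = 0 + 1 from rfl, coeff_succ_X_mul] at this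
    simp [coeff_exp, coeff_one] at this
    rw [← this]; exact one_ne_zero
  have hFu : IsUnit F := isUnit_iff_constantCoeff.2 (isUnit_iff_ne_zero.2 hF0)
  have hmul : (X : PowerSeries ℝ) ^ (N + 2 + 2) ∣ (S - G) * (exp ℝ - 1) ^ 2 := by
    rw [sub_mul, hS, sum_blockSeries_mul, hG, X_mul_derivative_bernoulli]
    obtain ⟨Q, hQ⟩ := X_pow_dvd_logExpPartial_sub (N + 1)
    refine ⟨exp ℝ * F * Q - exp ℝ * Q, ?_⟩
    rw [hF]
    linear_combination (X ^ 2 * exp ℝ * F - X ^ 2 * exp ℝ) * hQ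
  -- Since `e^t - 1` is `X` times a unit, cancelling its square costs exactly two orders.
  have hdvd : (X : PowerSeries ℝ) ^ (N + 2) ∣ S - G := by
    rw [hF, mul_pow, mul_left_comm, mul_comm, pow_add] at hmul
    have h := (mul_dvd_mul_iff_right (pow_ne_zero 2 X_ne_zero)).1 hmul
    exact (hFu.pow 2).dvd_mul_right.1 h
  have h0 := X_pow_dvd_iff.1 hdvd (N + 1) (by omega)
  rw [map_sub, sub_eq_zero, hS, hG, map_sum, coeff_succ_X_mul, coeff_derivative,
    coeff_succ_X_mul] at h0
  simp only [coeff_C_mul] at h0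
  rw [Nat.succ_eq_add_one, h0, bernoulli'PowerSeries, coeff_mk]
  simp [mul_comm]

end PowerSeriesIdentity

/-! ### Exponentials of triangular matrices and the logarithm `Z(v)`. -/

section Exponentials

open NormedSpace

lemma diagonal_fin_two (w : Fin 2 → ℝ) : Matrix.diagonal w = !![w 0, 0; 0, w 1] := by
  ext i j; fin_cases i <;> fin_cases j <;> simp

/-- The off-diagonal entry `s * (r - p)` is what conjugating `diag(p, r)` by the unipotent matrix
with entry `s` produces. -/
lemma exp_upper (p r s : ℝ) :
    exp (!![p, s * (r - p); 0, r] : Matrix (Fin 2) (Fin 2) ℝ) =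
      !![Real.exp p, s * (Real.exp r - Real.exp p); 0, Real.exp r] := by
  have h1 : (!![1, s; 0, 1] * !![1, -s; 0, 1] : Matrix (Fin 2) (Fin 2) ℝ) = 1 := by
    simp [Matrix.one_fin_two]
  have h2 : (!![1, -s; 0, 1] * !![1, s; 0, 1] : Matrix (Fin 2) (Fin 2) ℝ) = 1 := by
    simp [Matrix.one_fin_two]
  let U : (Matrix (Fin 2) (Fin 2) ℝ)ˣ := ⟨!![1, s; 0, 1], !![1, -s; 0, 1], h1, h2⟩
  have h := Matrix.exp_units_conj U (Matrix.diagonal ![p, r])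
  rw [Matrix.exp_diagonal] at h
  have e1 : (U : Matrix (Fin 2) (Fin 2) ℝ) * Matrix.diagonal ![p, r] *
      ((U⁻¹ : (Matrix (Fin 2) (Fin 2) ℝ)ˣ) : Matrix (Fin 2) (Fin 2) ℝ) =
      !![p, s * (r - p); 0, r] := by
    change !![1, s; 0, 1] * Matrix.diagonal ![p, r] * !![1, -s; 0, 1] = _
    rw [diagonal_fin_two]
    ext i j
    fin_cases i <;> fin_cases j <;> simp [Matrix.mul_apply, Fin.sum_univ_two] <;> ring
  rw [e1] at h
  rw [h]
  change !![1, s; 0, 1] * Matrix.diagonal _ * !![1, -s; 0, 1] = _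
  rw [diagonal_fin_two]
  ext i j
  fin_cases i <;> fin_cases j <;>
    simp [Matrix.mul_apply, Fin.sum_univ_two, Pi.coe_exp, Real.exp_eq_exp_ℝ] <;> ring

lemma exp_xMat (v : ℝ) :
    exp (xMat v) = !![Real.exp (-v), 0; 0, Real.exp (-2 * v)] := by
  simpa [xMat] using exp_upper (-v) (-2 * v) 0

lemma exp_yMat : exp yMat = !![1, 1; 0, 1] := by
  have hy : yMat * yMat = 0 := by
    ext i j; fin_cases i <;> fin_cases j <;> simp [yMat]
  have hs : HasSum (fun n : ℕ => ((n.factorial : ℚ)⁻¹) • yMat ^ n)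
      (∑ n ∈ Finset.range 2, ((n.factorial : ℚ)⁻¹) • yMat ^ n) := by
    apply hasSum_sum_of_ne_finset_zero
    intro n hn
    obtain ⟨m, rfl⟩ : ∃ m, n = 2 + m := ⟨n - 2, by simp at hn; omega⟩
    rw [pow_add, pow_two, hy, zero_mul, smul_zero]
  rw [exp_eq_tsum ℚ]
  change (∑' n : ℕ, ((n.factorial : ℚ)⁻¹) • yMat ^ n) = _
  rw [hs.tsum_eq]
  ext i j
  fin_cases i <;> fin_cases j <;> simp [Finset.sum_range_succ, yMat]

lemma exp_xMat_mul_exp_yMat (v : ℝ) :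
    exp (xMat v) * exp yMat =
      !![Real.exp (-v), Real.exp (-v); 0, Real.exp (-v) ^ 2] := by
  rw [exp_xMat, exp_yMat, ← Real.exp_nat_mul]
  ext i j
  fin_cases i <;> fin_cases j <;> simp [Matrix.mul_apply, Fin.sum_univ_two]

lemma isLogarithm_zMat (v : ℝ) :
    IsLogarithm (zMat v) (exp (xMat v) * exp yMat) := by
  rw [IsLogarithm]
  by_cases hv : v = 0
  · subst hv
    have h : zMat 0 = yMat := by simp [zMat, yMat, todd]
    have h' : xMat 0 = 0 := by
      ext i j; fin_cases i <;> fin_cases j <;> simp [xMat]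
    rw [h, h', exp_zero, one_mul]
  · have hne : 1 - Real.exp (-v) ≠ 0 := by
      rw [sub_ne_zero, ne_comm, Ne, Real.exp_eq_one_iff]; simpa using hv
    have h : zMat v = !![-v, -(1 - Real.exp (-v))⁻¹ * (-2 * v - -v); 0, -2 * v] := by
      rw [zMat, todd, if_neg hv]
      congr 3
      field_simp
      ring_nf
    rw [h, exp_upper, exp_xMat_mul_exp_yMat]
    have h2 : Real.exp (-2 * v) = Real.exp (-v) ^ 2 := by
      rw [← Real.exp_nat_mul]; norm_num
    rw [h2]
    have : -(1 - Real.exp (-v))⁻¹ * (Real.exp (-v) ^ 2 - Real.exp (-v)) = Real.exp (-v) := by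
      field_simp; ring
    rw [this]

end Exponentials

/-! ### Dynkin brackets when `[x, y] = v y`. -/

section Dynkin

variable {L : Type*} [LieRing L] [LieAlgebra ℝ L]

lemma mem_dynkinIndices {n k : ℕ} {p : Fin k → ℕ × ℕ} :
    p ∈ dynkinIndices n k ↔ (∀ l, p l ≠ (0, 0)) ∧ ∑ l, ((p l).1 + (p l).2) = n := by
  simp only [dynkinIndices, Finset.mem_filter, Fintype.mem_piFinset, Finset.mem_product,
    Finset.mem_range, and_iff_right_iff_imp]
  rintro ⟨-, h⟩ l
  have := Finset.single_le_sum (f := fun l => (p l).1 + (p l).2) (fun _ _ => Nat.zero_le _)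
    (Finset.mem_univ l)
  simp only [h] at this
  omega

/-- The part of `Z_n` coming from `k` blocks, up to the factor `(-1)^(k+1)/(nk)`. -/
noncomputable def dynkinSum (x y : L) (n k : ℕ) : L :=
  ∑ p ∈ dynkinIndices n k,
    (1 / (∏ l, (((p l).1.factorial : ℝ) * ((p l).2.factorial : ℝ)))) •
      dynkinBracket x y (List.ofFn p)

/-- The pairs `(i, j) ≠ (0, 0)` with `i + j = d`. -/
def blockIndices (d : ℕ) : Finset (ℕ × ℕ) :=
  (Finset.HasAntidiagonal.antidiagonal d).filter (· ≠ (0, 0))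

lemma blockIndices_zero : blockIndices 0 = ∅ := rfl

/-- The degree `d` part of `e^{ad x} e^{ad y} - 1`. -/
noncomputable def blockOperator (x y : L) (d : ℕ) : L →ₗ[ℝ] L :=
  ∑ q ∈ blockIndices d, (1 / ((q.1.factorial : ℝ) * (q.2.factorial : ℝ))) •
    ((LieAlgebra.ad ℝ L x) ^ q.1 * (LieAlgebra.ad ℝ L y) ^ q.2)

lemma dynkinSum_one (x y : L) (n : ℕ) :
    dynkinSum x y n 1 = ∑ q ∈ blockIndices n,
      (1 / ((q.1.factorial : ℝ) * (q.2.factorial : ℝ))) • dynkinBracket x y [q] := by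
  refine Finset.sum_nbij' (fun p => p 0) (fun q _ => q) ?_ ?_ ?_ ?_ ?_
  · intro p hp
    rw [mem_dynkinIndices] at hp
    simp only [Fin.sum_univ_one] at hp
    simpa [blockIndices] using ⟨hp.2, hp.1 0⟩
  · intro q hq
    rw [mem_dynkinIndices]
    simpa [blockIndices, and_comm] using hq
  · intro p _
    ext l <;> rw [Subsingleton.elim l 0]
  · intro q _; rfl
  · intro p _; simp

lemma dynkinBracket_cons (x y : L) (q : ℕ × ℕ) {l : List (ℕ × ℕ)} (hl : l ≠ []) :
    dynkinBracket x y (q :: l) =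
      ((LieAlgebra.ad ℝ L x) ^ q.1 * (LieAlgebra.ad ℝ L y) ^ q.2) (dynkinBracket x y l) := by
  cases l with
  | nil => exact absurd rfl hl
  | cons r s => rfl

/-- Peels off the outermost block and sorts by its degree. -/
lemma dynkinSum_succ (x y : L) (n k : ℕ) :
    dynkinSum x y n (k + 2) = ∑ a ∈ Finset.HasAntidiagonal.antidiagonal n,
      blockOperator x y a.1 (dynkinSum x y a.2 (k + 1)) := by
  simp only [blockOperator, LinearMap.sum_apply, dynkinSum, map_sum, Finset.sum_sigma',
    LinearMap.smul_apply]
  refine Finset.sum_nbij'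
    (fun p => ⟨((p 0).1 + (p 0).2, ∑ l, ((Fin.tail p l).1 + (Fin.tail p l).2)), Fin.tail p, p 0⟩)
    (fun s => Fin.cons s.2.2 s.2.1) ?_ ?_ ?_ ?_ ?_
  · intro p hp
    rw [mem_dynkinIndices, Fin.sum_univ_succ] at hp
    simp only [Finset.mem_sigma, Finset.HasAntidiagonal.mem_antidiagonal, mem_dynkinIndices, blockIndices,
      Finset.mem_filter]
    exact ⟨hp.2, ⟨fun l => hp.1 l.succ, trivial⟩, trivial, hp.1 0⟩
  · rintro ⟨⟨d, m⟩, p, q⟩ h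
    simp only [Finset.mem_sigma, Finset.HasAntidiagonal.mem_antidiagonal, mem_dynkinIndices, blockIndices,
      Finset.mem_filter] at h
    obtain ⟨h1, ⟨h4, h5⟩, h2, h3⟩ := h
    rw [mem_dynkinIndices]
    refine ⟨fun l => ?_, ?_⟩
    · refine Fin.cases ?_ (fun l => ?_) l
      · exact h3
      · exact h4 l
    · rw [Fin.sum_univ_succ]
      simp only [Fin.cons_zero, Fin.cons_succ]
      omega
  · intro p _
    exact Fin.cons_self_tail p
  · rintro ⟨⟨d, m⟩, p, q⟩ h
    simp only [Finset.mem_sigma, Finset.HasAntidiagonal.mem_antidiagonal, mem_dynkinIndices, blockIndices,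
      Finset.mem_filter] at h
    obtain ⟨h1, ⟨h4, h5⟩, h2, h3⟩ := h
    simp only [Fin.cons_zero, Fin.tail_cons, h2, h5]
  · intro p _
    rw [Fin.prod_univ_succ, ← one_div_mul_one_div, mul_smul, map_smul, List.ofFn_succ,
      dynkinBracket_cons x y _ (by simp)]
    rfl

variable {x y : L} {v : ℝ}

lemma ad_pow_eigen (hxy : ⁅x, y⁆ = v • y) (i : ℕ) :
    ((LieAlgebra.ad ℝ L x) ^ i) y = v ^ i • y := by
  induction i with
  | zero => simp
  | succ i ih => rw [pow_succ', Module.End.mul_apply, ih, map_smul, LieAlgebra.ad_apply, hxy,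
      smul_smul, pow_succ]

lemma ad_pow_self (x : L) (i : ℕ) :
    ((LieAlgebra.ad ℝ L x) ^ i) x = if i = 0 then x else 0 := by
  cases i with
  | zero => simp
  | succ i => simp [pow_succ]

lemma ad_pow_other (hxy : ⁅x, y⁆ = v • y) (j : ℕ) :
    ((LieAlgebra.ad ℝ L y) ^ j) x = if j = 0 then x else if j = 1 then -(v • y) else 0 := by
  match j with
  | 0 => simp
  | 1 => simp [← hxy]
  | j + 2 =>
    have : ⁅y, x⁆ = -(v • y) := by rw [← hxy, lie_skew]
    simp [pow_succ, this]

open PowerSeries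

lemma coeff_exp_sub_one (d : ℕ) :
    coeff d (exp ℝ - 1) = if d = 0 then 0 else (1 / d.factorial : ℝ) := by
  rw [map_sub, coeff_exp, coeff_one]
  split_ifs with h <;> simp [h]

lemma blockOperator_apply_right (hxy : ⁅x, y⁆ = v • y) (d : ℕ) :
    blockOperator x y d y = (v ^ d * coeff d (exp ℝ - 1)) • y := by
  rw [blockOperator, LinearMap.sum_apply, coeff_exp_sub_one]
  cases d with
  | zero => simp [blockIndices_zero]
  | succ d =>
    rw [Finset.sum_eq_single (d + 1, 0)]
    · simp [ad_pow_eigen hxy, smul_smul, mul_comm]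
    · rintro ⟨i, j⟩ hq hne
      simp only [blockIndices, Finset.mem_filter, Finset.HasAntidiagonal.mem_antidiagonal] at hq
      have hj : j ≠ 0 := by
        rintro rfl; exact hne (by ext <;> simp; omega)
      simp [ad_pow_self, hj]
    · simp [blockIndices]

lemma blockOperator_apply_left (hxy : ⁅x, y⁆ = v • y) (d : ℕ) :
    blockOperator x y d x = -(v ^ d * coeff d (X * exp ℝ)) • y := by
  rw [blockOperator, LinearMap.sum_apply]
  cases d with
  | zero => simp [blockIndices_zero]
  | succ d =>
    rw [Finset.sum_eq_single (d, 1), coeff_succ_X_mul, coeff_exp]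
    · rw [LinearMap.smul_apply, Module.End.mul_apply, ad_pow_other hxy, if_neg one_ne_zero,
        if_pos rfl, map_neg, map_smul, ad_pow_eigen hxy, smul_neg, smul_smul, smul_smul, neg_smul]
      congr 2
      simp
      ring
    · rintro ⟨i, j⟩ hq hne
      simp only [blockIndices, Finset.mem_filter, Finset.HasAntidiagonal.mem_antidiagonal] at hq
      have hj : j ≠ 1 := by
        rintro rfl; exact hne (by ext <;> simp; omega)
      by_cases hj0 : j = 0
      · subst hj0
        have hi : i ≠ 0 := by omega
        simp [ad_pow_self, hi]
      · simp [ad_pow_other hxy, hj, hj0]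
    · simp [blockIndices]

lemma dynkinSum_one_eq (hxy : ⁅x, y⁆ = v • y) (n : ℕ) :
    dynkinSum x y n 1 =
      coeff n (X : PowerSeries ℝ) • x + (v ^ (n - 1) * coeff n (X * exp ℝ)) • y := by
  rw [dynkinSum_one]
  match n with
  | 0 => simp [blockIndices_zero]
  | 1 =>
    rw [blockIndices]
    have h : coeff 1 (X * exp ℝ) = 1 := by
      rw [show (1 : ℕ) = 0 + 1 from rfl, coeff_succ_X_mul]; simp
    simp [h, dynkinBracket, Finset.sum_filter, coeff_one_X, Finset.Nat.antidiagonal_succ, add_comm]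
  | d + 2 =>
    rw [Finset.sum_eq_single (d + 1, 1), coeff_succ_X_mul, coeff_exp, coeff_X]
    · simp [dynkinBracket, ad_pow_eigen hxy, smul_smul, mul_comm]
    · rintro ⟨i, j⟩ hq hne
      simp only [blockIndices, Finset.mem_filter, Finset.HasAntidiagonal.mem_antidiagonal] at hq
      have hj : j ≠ 1 := by
        rintro rfl; exact hne (by ext <;> simp; omega)
      by_cases hj0 : j = 0
      · subst hj0
        have hi : i - 1 ≠ 0 := by omega
        simp [dynkinBracket, ad_pow_self, hi]
      · have : j - 1 ≠ 0 := by omega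
        simp [dynkinBracket, ad_pow_self, hj0, this]
    · simp [blockIndices]

lemma constantCoeff_blockSeries (k : ℕ) : coeff 0 (blockSeries k) = 0 := by
  cases k <;> simp [blockSeries]

/-- Another block multiplies the `y`-part by `e^t - 1`. It also turns an `x`-part, present only for
a single block, into a multiple of `y`. -/
lemma dynkinSum_eq (hxy : ⁅x, y⁆ = v • y) (k n : ℕ) :
    dynkinSum x y n (k + 1) =
      coeff n (if k = 0 then X else 0 : PowerSeries ℝ) • x +
        (v ^ (n - 1) * coeff n (blockSeries k)) • y := by
  induction k generalizing n with
  | zero => simpa [blockSeries] using dynkinSum_one_eq hxy n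
  | succ k ih =>
    have hrec : blockSeries (k + 1) = (exp ℝ - 1) * blockSeries k -
        X * exp ℝ * (if k = 0 then X else 0) := by
      cases k <;> simp [blockSeries] <;> ring
    rw [dynkinSum_succ, hrec, map_sub, coeff_mul, coeff_mul, ← Finset.sum_sub_distrib,
      Finset.mul_sum, Finset.sum_smul]
    simp only [Nat.succ_ne_zero, if_false, map_zero, zero_smul, zero_add]
    refine Finset.sum_congr rfl fun a ha => ?_
    obtain ⟨d, m⟩ := a
    rw [Finset.HasAntidiagonal.mem_antidiagonal] at ha
    simp only at ha ⊢
    subst ha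
    rw [ih, map_add, map_smul, map_smul, blockOperator_apply_left hxy,
      blockOperator_apply_right hxy, smul_smul, smul_smul, ← add_smul]
    congr 1
    -- At `m = 0` the truncated exponent `m - 1` is harmless, as both tail coefficients vanish.
    cases m with
    | zero => split_ifs <;> simp [constantCoeff_blockSeries, -coeff_zero_eq_constantCoeff]
    | succ m =>
      rw [show d + (m + 1) - 1 = d + m by omega, Nat.add_sub_cancel]
      split_ifs with hk
      · rw [coeff_X]
        split_ifs with hm
        · obtain rfl : m = 0 := by omega
          ring
        · ring
      · simp; ring

/-- The homogeneous components of the BCH series when `[x, y] = v y`. -/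
theorem bchTerm_eq (hxy : ⁅x, y⁆ = v • y) (n : ℕ) (hn : 2 ≤ n) :
    bchTerm x y n =
      (v ^ (n - 1) * ((bernoulli' (n - 1) : ℝ) / ((n - 1).factorial : ℝ))) • y := by
  have h1 : bchTerm x y n = (1 / (n : ℝ)) • ∑ k ∈ Finset.range n,
      ((-1 : ℝ) ^ (k + 2) / ((k + 1 : ℕ) : ℝ)) • dynkinSum x y n (k + 1) := by
    rw [bchTerm, Finset.range_eq_Ico, Finset.sum_Ico_add' (fun k : ℕ =>
      ((-1 : ℝ) ^ (k + 1) / (k : ℝ)) • dynkinSum x y n k) 0 n 1]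
    rfl
  have h2 : ∀ k, dynkinSum x y n (k + 1) = (v ^ (n - 1) * coeff n (blockSeries k)) • y := by
    intro k
    rw [dynkinSum_eq hxy]
    have : coeff n (if k = 0 then X else 0 : PowerSeries ℝ) = 0 := by
      split_ifs
      · rw [coeff_X, if_neg (by omega)]
      · simp
    rw [this, zero_smul, zero_add]
  have hn0 : (n : ℝ) ≠ 0 := by positivity
  simp only [h1, h2, smul_smul, ← Finset.sum_smul]
  congr 1
  have h3 := sum_coeff_blockSeries n (by omega)
  have h4 : ∑ k ∈ Finset.range n, (-1 : ℝ) ^ (k + 2) / ((k + 1 : ℕ) : ℝ) *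
      (v ^ (n - 1) * coeff n (blockSeries k)) = v ^ (n - 1) *
      ∑ k ∈ Finset.range n, (-1 : ℝ) ^ (k + 2) / ((k + 1 : ℕ) : ℝ) * coeff n (blockSeries k) := by
    rw [Finset.mul_sum]
    exact Finset.sum_congr rfl fun k _ => by ring
  rw [h4, h3]
  field_simp

end Dynkin

/-! ### Convergence of the BCH and Mercator series. -/

section Convergence

lemma lie_xMat_yMat (v : ℝ) : ⁅xMat v, yMat⁆ = v • yMat := by
  rw [LieRing.of_associative_ring_bracket]
  ext i j
  fin_cases i <;> fin_cases j <;> simp [xMat, yMat]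
  ring

/-- The terms of a convergent series tend to zero. -/
lemma SeriesConverges.tendsto_zero {E : Type*} [AddCommGroup E] [TopologicalSpace E]
    [IsTopologicalAddGroup E] {a : ℕ → E} (h : SeriesConverges a) : Tendsto a atTop (𝓝 0) := by
  obtain ⟨S, hS⟩ := h
  rw [← tendsto_add_atTop_iff_nat 1]
  have h1 := ((tendsto_add_atTop_iff_nat 1).2 hS).sub hS
  rw [sub_self] at h1
  refine h1.congr fun n => ?_
  rw [Finset.sum_Icc_succ_top (by omega), add_sub_cancel_left]

lemma seriesConverges_of_summable {E : Type*} [AddCommGroup E] [TopologicalSpace E]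
    [IsTopologicalAddGroup E] {a : ℕ → E} (h : Summable a) : SeriesConverges a := by
  have h1 : Summable fun n => a (n + 1) := (summable_nat_add_iff 1).2 h
  refine ⟨∑' n, a (n + 1), h1.hasSum.tendsto_sum_nat.congr fun N => ?_⟩
  rw [Finset.range_eq_Ico, Finset.sum_Ico_add' a 0 N 1]
  rfl

lemma SeriesConverges.matrix_entry {m n : Type*} {a : ℕ → Matrix m n ℝ}
    (h : SeriesConverges a) (i : m) (j : n) : SeriesConverges fun k => a k i j := by
  obtain ⟨S, hS⟩ := h
  refine ⟨S i j, ?_⟩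
  have := (tendsto_pi_nhds.1 (tendsto_pi_nhds.1 hS i)) j
  simpa [Matrix.sum_apply] using this

lemma seriesConverges_matrix {m n : Type*} {a : ℕ → Matrix m n ℝ}
    (h : ∀ i j, SeriesConverges fun k => a k i j) : SeriesConverges a := by
  choose S hS using h
  refine ⟨Matrix.of S, tendsto_pi_nhds.2 fun i => tendsto_pi_nhds.2 fun j => ?_⟩
  simpa [Matrix.sum_apply] using hS i j

/-- `|b_{2k}| (2π)^{2k} / (2k)! = 2 ζ(2k)`. -/
lemma abs_bernoulli_mul (k : ℕ) (hk : k ≠ 0) :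
    |(bernoulli' (2 * k) : ℝ) / ((2 * k).factorial : ℝ)| * (2 * Real.pi) ^ (2 * k) =
      2 * ∑' n : ℕ, 1 / (n : ℝ) ^ (2 * k) := by
  have h := (hasSum_zeta_nat hk).tsum_eq
  have hpos : 0 ≤ ∑' n : ℕ, 1 / (n : ℝ) ^ (2 * k) := tsum_nonneg fun n => by positivity
  rw [← abs_of_nonneg hpos, h, bernoulli_eq_bernoulli'_of_ne_one (by omega)]
  have h2 : (2 : ℝ) ^ (2 * k) = 2 * 2 ^ (2 * k - 1) := by
    rw [← pow_succ']; congr 1; omega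
  simp only [abs_mul, abs_div, abs_pow, abs_neg, abs_one, one_pow, one_mul, Nat.abs_cast,
    Nat.abs_ofNat, abs_of_pos Real.pi_pos, mul_pow, h2]
  ring

lemma summable_one_div_pow (k : ℕ) (hk : k ≠ 0) :
    Summable fun n : ℕ => 1 / (n : ℝ) ^ (2 * k) := (hasSum_zeta_nat hk).summable

lemma one_le_tsum (k : ℕ) (hk : k ≠ 0) : 1 ≤ ∑' n : ℕ, 1 / (n : ℝ) ^ (2 * k) := by
  simpa using (summable_one_div_pow k hk).le_tsum 1 fun n _ => by positivity

lemma tsum_le_tsum_two (k : ℕ) (hk : k ≠ 0) :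
    ∑' n : ℕ, 1 / (n : ℝ) ^ (2 * k) ≤ ∑' n : ℕ, 1 / (n : ℝ) ^ (2 * 1) := by
  refine (summable_one_div_pow k hk).tsum_le_tsum (fun n => ?_) (summable_one_div_pow 1 one_ne_zero)
  rcases Nat.eq_zero_or_pos n with rfl | hn
  · simp [hk]
  · have : (1 : ℝ) ≤ n := by exact_mod_cast hn
    exact one_div_le_one_div_of_le (by positivity) (pow_le_pow_right₀ this (by omega))

/-- The Taylor coefficients of Todd's function. -/
noncomputable def toddCoeff (n : ℕ) : ℝ := (bernoulli' n : ℝ) / (n.factorial : ℝ)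

lemma summable_toddCoeff (v : ℝ) (hv : |v| < 2 * Real.pi) :
    Summable fun n => v ^ n * toddCoeff n := by
  have hpi : 0 < 2 * Real.pi := by positivity
  have hr : |v| / (2 * Real.pi) < 1 := (div_lt_one hpi).2 hv
  rw [← summable_nat_add_iff 2]
  have hg : Summable fun n : ℕ => (2 * ∑' n : ℕ, 1 / (n : ℝ) ^ (2 * 1)) *
      (|v| / (2 * Real.pi)) ^ (n + 2) :=
    ((summable_nat_add_iff 2).2 (summable_geometric_of_lt_one (by positivity) hr)).mul_left _
  refine Summable.of_norm_bounded hg fun n => ?_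
  have hz : 0 ≤ ∑' n : ℕ, 1 / (n : ℝ) ^ (2 * 1) := zero_le_one.trans (one_le_tsum 1 one_ne_zero)
  rcases Nat.even_or_odd (n + 2) with he | ho
  · obtain ⟨k, hk⟩ := he
    obtain rfl | hk0 := eq_or_ne k 0
    · omega
    have hk' : n + 2 = 2 * k := by omega
    rw [hk', toddCoeff, norm_mul, norm_pow, Real.norm_eq_abs, Real.norm_eq_abs, div_pow,
      ← mul_div_assoc, le_div_iff₀ (by positivity), mul_assoc, abs_bernoulli_mul k hk0, mul_comm]
    exact mul_le_mul_of_nonneg_right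
      (mul_le_mul_of_nonneg_left (tsum_le_tsum_two k hk0) zero_le_two) (by positivity)
  -- The shift by 2 skips `b_1`, the only nonzero Bernoulli number of odd index.
  · rw [toddCoeff, bernoulli'_eq_zero_of_odd ho (by omega)]
    simp
    positivity

lemma two_le_abs_toddCoeff (v : ℝ) (hv : 2 * Real.pi ≤ |v|) (k : ℕ) (hk : k ≠ 0) :
    2 ≤ |v ^ (2 * k) * toddCoeff (2 * k)| := by
  have h := abs_bernoulli_mul k hk
  have h1 := one_le_tsum k hk
  have h2 : (2 * Real.pi) ^ (2 * k) ≤ |v| ^ (2 * k) :=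
    pow_le_pow_left₀ (by positivity) hv _
  rw [abs_mul, abs_pow, toddCoeff, mul_comm]
  have := mul_le_mul_of_nonneg_left h2
    (abs_nonneg ((bernoulli' (2 * k) : ℝ) / ((2 * k).factorial : ℝ)))
  linarith

theorem seriesConverges_bchTerm (v : ℝ) :
    SeriesConverges (fun n : ℕ => bchTerm (xMat v) yMat n) ↔ |v| < 2 * Real.pi := by
  have key : ∀ n, bchTerm (xMat v) yMat (n + 2) = (v ^ (n + 1) * toddCoeff (n + 1)) • yMat :=
    fun n => bchTerm_eq (lie_xMat_yMat v) (n + 2) (by omega)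
  constructor
  · intro h
    by_contra! hv
    -- `Z_{2k+1}` carries the even coefficient `b_{2k}`, so along odd degrees the entry stays at
    -- least 2 in absolute value.
    have h0 := ((h.matrix_entry 0 1).tendsto_zero).comp
      (tendsto_atTop_mono (f := id) (g := fun k : ℕ => 2 * k + 1) (fun k => by simp; omega)
        tendsto_id)
    have h1 := (h0.abs).eventually_lt_const (u := 2) (by simp)
    obtain ⟨k, hk, hk0⟩ := (h1.and (eventually_ne_atTop 0)).exists
    obtain ⟨m, rfl⟩ := Nat.exists_eq_succ_of_ne_zero hk0
    have h2 := key (2 * m + 1)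
    rw [show 2 * m + 1 + 2 = 2 * m.succ + 1 by omega,
      show 2 * m + 1 + 1 = 2 * m.succ by omega] at h2
    have h3 := two_le_abs_toddCoeff v hv m.succ hk0
    rw [Function.comp_apply, h2, Matrix.smul_apply, smul_eq_mul, show yMat 0 1 = 1 from rfl,
      mul_one] at hk
    exact absurd hk h3.not_gt
  · intro hv
    refine seriesConverges_matrix fun i j => seriesConverges_of_summable ?_
    rw [← summable_nat_add_iff 2]
    simp only [key, Matrix.smul_apply, smul_eq_mul]
    exact ((summable_nat_add_iff 1).2 (summable_toddCoeff v hv)).mul_right (yMat i j)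

/-- The scalar Mercator series converges for `-1 < t ≤ 1`. -/
lemma seriesConverges_log {t : ℝ} (h1 : -1 < t) (h2 : t ≤ 1) :
    SeriesConverges fun n : ℕ => (-1 : ℝ) ^ (n + 1) / (n : ℝ) * t ^ n := by
  rcases h2.lt_or_eq with h2 | rfl
  · apply seriesConverges_of_summable
    have ht : |t| < 1 := abs_lt.2 ⟨h1, h2⟩
    refine Summable.of_norm_bounded (summable_geometric_of_lt_one (abs_nonneg t) ht) fun n => ?_
    rw [norm_mul, norm_div, norm_pow, norm_pow, norm_neg, norm_one, one_pow, Real.norm_natCast,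
      Real.norm_eq_abs]
    refine mul_le_of_le_one_left (by positivity) ?_
    rcases Nat.eq_zero_or_pos n with rfl | hn
    · simp
    · exact (div_le_one (by positivity)).2 (by exact_mod_cast hn)
  -- Endpoint `t = 1`: the alternating harmonic series.
  · have ha : Antitone fun n : ℕ => 1 / ((n : ℝ) + 1) := fun m n h => by
      dsimp only
      gcongr
    obtain ⟨l, hl⟩ := ha.tendsto_alternating_series_of_tendsto_zero
      tendsto_one_div_add_atTop_nhds_zero_nat
    refine ⟨l, hl.congr fun N => ?_⟩
    have := Finset.sum_Ico_add' (fun n : ℕ => (-1 : ℝ) ^ (n + 1) / (n : ℝ) * 1 ^ n) 0 N 1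
    rw [← Finset.range_eq_Ico] at this
    refine Eq.trans (Finset.sum_congr rfl fun n _ => ?_) this
    simp [pow_succ, div_eq_mul_inv]

lemma not_seriesConverges_log {t : ℝ} (h : 1 < t) :
    ¬ SeriesConverges fun n : ℕ => (-1 : ℝ) ^ (n + 1) / (n : ℝ) * t ^ n := by
  intro hc
  have h0 := hc.tendsto_zero.abs
  have hone := tendsto_pow_const_div_const_pow_of_one_lt 1 h
  rw [abs_zero] at h0
  have h1 := h0.eventually_lt_const (u := 1) one_pos
  have h2 := hone.eventually_lt_const (u := 1) one_pos
  obtain ⟨n, ⟨hn1, hn2⟩, hn0⟩ := ((h1.and h2).and (eventually_ne_atTop 0)).exists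
  have hnp : (0 : ℝ) < n := by positivity
  have htp : 0 < t ^ n := by positivity
  rw [abs_mul, abs_div, abs_pow, abs_neg, abs_one, one_pow, abs_of_pos hnp, abs_of_pos htp,
    one_div, inv_mul_eq_div, div_lt_one hnp] at hn1
  rw [pow_one, div_lt_one htp] at hn2
  linarith

lemma upper_pow (p r s : ℝ) (n : ℕ) :
    (!![p, s * (r - p); 0, r] : Matrix (Fin 2) (Fin 2) ℝ) ^ n =
      !![p ^ n, s * (r ^ n - p ^ n); 0, r ^ n] := by
  induction n with
  | zero => simp [Matrix.one_fin_two]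
  | succ n ih =>
    rw [pow_succ, ih]
    ext i j
    fin_cases i <;> fin_cases j <;> simp [Matrix.mul_apply, Fin.sum_univ_two] <;> ring

lemma SeriesConverges.smul_sub {a b : ℕ → ℝ} (ha : SeriesConverges a) (hb : SeriesConverges b)
    (s : ℝ) : SeriesConverges fun n => s * (a n - b n) := by
  obtain ⟨A, hA⟩ := ha
  obtain ⟨B, hB⟩ := hb
  refine ⟨s * (A - B), ((hA.sub hB).const_mul s).congr fun N => ?_⟩
  rw [← Finset.sum_sub_distrib, Finset.mul_sum]

theorem seriesConverges_mercatorTerm (v : ℝ) :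
    SeriesConverges (fun n : ℕ => mercatorTerm (xMat v) yMat n) ↔
      -Real.log (Real.sqrt 2) ≤ v := by
  have hiff : -Real.log (Real.sqrt 2) ≤ v ↔ Real.exp (-v) ^ 2 - 1 ≤ 1 := by
    rw [neg_le, Real.le_log_iff_exp_le (by positivity), sub_le_iff_le_add, one_add_one_eq_two]
    exact Real.le_sqrt' (Real.exp_pos _)
  rw [hiff]
  set a := Real.exp (-v) with ha
  have hapos : 0 < a := Real.exp_pos _
  have hterm : ∀ n, mercatorTerm (xMat v) yMat n =
      ((-1 : ℝ) ^ (n + 1) / (n : ℝ)) • !![a - 1, a; 0, a ^ 2 - 1] ^ n := by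
    intro n
    rw [mercatorTerm, exp_xMat_mul_exp_yMat, Matrix.one_fin_two]
    simp [ha]
  simp only [hterm]
  -- At `a = 1` the eigenvalues coincide and `upper_pow` does not apply, but the matrix is nilpotent
  -- and the series finite.
  by_cases ha1 : a = 1
  · rw [ha1]
    norm_num
    apply seriesConverges_of_summable
    refine summable_of_ne_finset_zero (s := Finset.range 2) fun n hn => ?_
    obtain ⟨m, rfl⟩ : ∃ m, n = 2 + m := ⟨n - 2, by simp at hn; omega⟩
    have hy : (!![0, 1; 0, 0] : Matrix (Fin 2) (Fin 2) ℝ) ^ 2 = 0 := by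
      ext i j; fin_cases i <;> fin_cases j <;> simp [pow_two]
    rw [pow_add !![0, 1; 0, (0 : ℝ)], hy, zero_mul, smul_zero]
  · have hM : (!![a - 1, a; 0, a ^ 2 - 1] : Matrix (Fin 2) (Fin 2) ℝ) =
        !![a - 1, (a - 1)⁻¹ * ((a ^ 2 - 1) - (a - 1)); 0, a ^ 2 - 1] := by
      have : a - 1 ≠ 0 := sub_ne_zero.2 ha1
      have h : (a - 1)⁻¹ * ((a ^ 2 - 1) - (a - 1)) = a := by
        field_simp
        ring
      rw [h]
    simp only [hM, upper_pow]
    constructor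
    · intro h
      by_contra! hlt
      refine not_seriesConverges_log hlt ?_
      simpa using h.matrix_entry 1 1
    · intro h
      -- Positivity of `a` gives both lower bounds; `a ^ 2 ≤ 2` also forces `a - 1 ≤ 1`.
      have h2 := seriesConverges_log (by nlinarith : -1 < a ^ 2 - 1) h
      have h1 := seriesConverges_log (by linarith : -1 < a - 1) (by nlinarith)
      refine seriesConverges_matrix fun i j => ?_
      fin_cases i <;> fin_cases j
      · simpa using h1
      · convert! h2.smul_sub h1 (a - 1)⁻¹ using 2
        simp
        ring
      · exact ⟨0, by simp⟩
      · simpa using h2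

end Convergence
end BCHExample

theorem mainTheorem3 :
    (∀ v : ℝ, BCHExample.SeriesConverges
        (fun n : ℕ => BCHExample.mercatorTerm (BCHExample.xMat v) BCHExample.yMat n) ↔
      -Real.log (Real.sqrt 2) ≤ v) ∧
    (∀ v : ℝ, BCHExample.SeriesConverges
        (fun n : ℕ => BCHExample.bchTerm (BCHExample.xMat v) BCHExample.yMat n) ↔
      |v| < 2 * Real.pi) ∧
    (∀ v : ℝ, BCHExample.IsLogarithm (BCHExample.zMat v)
      (NormedSpace.exp (BCHExample.xMat v) * NormedSpace.exp BCHExample.yMat)) :=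
  ⟨BCHExample.seriesConverges_mercatorTerm, BCHExample.seriesConverges_bchTerm,
    BCHExample.isLogarithm_zMat⟩
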